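/- Let $q\ge 1$ be an integer. Define simple graphs $\mathcal G_q(g)$, $g\ge 0$, recursively: $\mathcal G_q(0)$ is the complete graph $K_{q+2}$ on $q+2$ vertices, and $\mathcal G_q(g+1)$ is obtained from $\mathcal G_q(g)$ by adding, for every edge $uv$ of $\mathcal G_q(g)$, a new complete graph $K_q$ each of whose $q$ vertices is joined to both $u$ and $v$ (all old edges being kept). For vertices $i,j$ of $\mathcal G_q(g)$ let $d_i$ denote the degree of $i$ and let $T_{ij}$ denote the hitting time from $i$ to $j$, i.e. the expected number of jumps until the random walk started at $i$, which at each step moves to a uniformly chosen neighbour of its current position, is at $j$ for the first time (so $T_{ii}=0$). Then for every $g\ge 0$ all the hitting times $T_{ij}$ are finite, and the additive-degree sum of hitting times $H^+_g=\sum_{i}\sum_{j}(d_i+d_j)\,T_{ij}$, taken over all ordered pairs of vertices of $\mathcal G_q(g)$, is $$ \begin{aligned} H^{+}_{g}={}&\frac{2(q+2)^2(q+1)^3}{(q+3)^2}\left(\frac{(q+1)(q+2)}{2}\right)^{2g}\\ &+\frac{(q+2)(3q+7)(q+1)^3(q^3+8q^2+22q+20)}{(q+3)^2(q^2+5q+8)}\left(\frac{(q+1)(q+2)}{2}\right)^{3g}\\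 &-\frac{(q+2)(q+4)(q+1)^3}{q+3}\left(\frac{(q+2)^2(q+1)^3}{4}\right)^{g}\\ &+\frac{(q+2)(q^2+9q+20)(q+1)^3}{(q+3)(q^2+5q+8)}\left(\frac{(q+2)(q+1)^2}{2}\right)^{g}\\ &+\frac{(q+2)(q+1)^3}{(q+3)^2}\left(\frac{(q+1)(q+2)}{2}\right)^{g}. \end{aligned} $$ -/

import Mathlib

open MeasureTheory ProbabilityTheory
open scoped ENNReal

noncomputable section

namespace EdgeCorona

/-- The operation that adds, for every edge `e` of `G`, a new complete graph on the `q` vertices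
`(e, a)`, `a : Fin q`, each of which is joined to both ends of `e`. The old vertices are `Sum.inl u`,
and the old edges are kept. -/
def edgeCorona (q : ℕ) {V : Type} (G : SimpleGraph V) :
    SimpleGraph (V ⊕ (G.edgeSet × Fin q)) where
  Adj x y :=
    match x, y with
    | Sum.inl u, Sum.inl v => G.Adj u v
    | Sum.inl u, Sum.inr (e, _) => u ∈ (e : Sym2 V)
    | Sum.inr (e, _), Sum.inl u => u ∈ (e : Sym2 V)
    | Sum.inr (e, a), Sum.inr (f, b) => e = f ∧ a ≠ b
  symm := ⟨by
    rintro (u | ⟨e, a⟩) (v | ⟨f, b⟩) h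
    · exact G.adj_symm h
    · exact h
    · exact h
    · exact ⟨h.1.symm, h.2.symm⟩⟩
  loopless := ⟨by
    rintro (u | ⟨e, a⟩) h
    · exact G.irrefl h
    · exact h.2 rfl⟩

/-- Vertex type and graph after `g` iterations, starting from the complete graph on `q + 2`
vertices. -/
def network (q : ℕ) : ℕ → (V : Type) × SimpleGraph V
  | 0 => ⟨Fin (q + 2), ⊤⟩
  | g + 1 => ⟨(network q g).1 ⊕ ((network q g).2.edgeSet × Fin q), edgeCorona q (network q g).2⟩

/-- The vertex type of `𝒢_q(g)`. -/
def Vert (q g : ℕ) : Type := (network q g).1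

/-- The graph `𝒢_q(g)`. -/
def graph (q g : ℕ) : SimpleGraph (Vert q g) := (network q g).2

instance finite_vert (q g : ℕ) : Finite (Vert q g) := by
  induction g with
  | zero => exact inferInstanceAs (Finite (Fin (q + 2)))
  | succ g ih =>
    have : Finite (network q g).1 := ih
    exact inferInstanceAs
      (Finite ((network q g).1 ⊕ ((network q g).2.edgeSet × Fin q)))

instance fintypeVert (q g : ℕ) : Fintype (Vert q g) := Fintype.ofFinite _

section RandomWalk

variable {V : Type} [Fintype V]

open Classical in
/-- One step of the unbiased random walk on `G`: from `v` the walker jumps to a uniformly chosen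
neighbour of `v`. (A walker at a vertex without neighbours stays there.) -/
def step (G : SimpleGraph V) (v : V) : PMF V :=
  if h : (G.neighborFinset v).Nonempty then PMF.uniformOfFinset (G.neighborFinset v) h
  else PMF.pure v

/-- The transition kernel of the walk; the finite set `V` carries the discrete σ-algebra. -/
def walkKernel (G : SimpleGraph V) : @Kernel V V ⊤ ⊤ :=
  letI : MeasurableSpace V := ⊤
  { toFun := fun v => (step G v).toMeasure
    measurable' := measurable_from_top }

instance isMarkovKernel_walkKernel (G : SimpleGraph V) :
    @IsMarkovKernel V V ⊤ ⊤ (walkKernel G) :=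
  letI : MeasurableSpace V := ⊤
  ⟨fun v => PMF.toMeasure.isProbabilityMeasure (step G v)⟩

/-- The law of the trajectory `(X₀, X₁, X₂, …)` of the walk started at `X₀ = i`: the next position
is drawn from the transition kernel at the current position. -/
def walkLaw (G : SimpleGraph V) (i : V) : @Measure (ℕ → V) (@MeasurableSpace.pi ℕ _ fun _ => ⊤) :=
  letI : MeasurableSpace V := ⊤
  Kernel.traj (X := fun _ => V)
    (fun n => (walkKernel G).comap
      (fun x : (k : Finset.Iic n) → V => x ⟨n, Finset.mem_Iic.2 le_rfl⟩)
      (measurable_pi_apply _)) 0 (fun _ => i)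

/-- The first time (possibly `∞`) at which the trajectory `x` is at `j`. -/
def firstHit (j : V) (x : ℕ → V) : ℕ∞ :=
  hittingAfter (fun (n : ℕ) (y : ℕ → V) => y n) {j} 0 x

/-- The hitting time `T_{ij}`: the expected number of jumps until the walker started at `i` is at
`j` for the first time. -/
def hittingTime (G : SimpleGraph V) (i j : V) : ℝ≥0∞ :=
  letI : MeasurableSpace V := ⊤
  ∫⁻ x, (firstHit j x : ℝ≥0∞) ∂(walkLaw G i)

open Classical in
/-- The additive-degree sum of hitting times `∑_i ∑_j (d_i + d_j) T_{ij}`, as a real number (only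
meaningful if every hitting time is finite). -/
def additiveDegreeSum (G : SimpleGraph V) : ℝ :=
  ∑ i, ∑ j, ((G.degree i : ℝ) + (G.degree j : ℝ)) * (hittingTime G i j).toReal

end RandomWalk

end EdgeCorona

end

/-! A finite nonnegative solution of the first-step equations for the target `j` must be the vector
of hitting times of `j` (`tsum_survival_eq`). It therefore suffices to exhibit the hitting times of
the edge corona in terms of those of `G` and to check the equations. With `D` the degree sum and `L`
the Laplacian, they read `L T(·, j) = d - D·1_j`; the value at `j` itself is forced, since a
Laplacian sums to zero.

For an old target, times between old vertices are multiplied by `q + 1`, and a new vertex over `uv`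
leaves its clique through `u` or `v` with equal probability. For a new target over `uv`, the same
extension is applied to the mean of the columns `u` and `v` plus a constant, and a multiple of a
potential supported on that clique (`bump`) moves the sink from the two ends to the target.
Nonnegativity of this table needs the commute time across an edge to be at most `D`, so that bound
is carried along the induction (`IsHittingTable.corTable`).

Summing the table gives linear recursions. The multiplicative-degree sum depends on itself, on `D`
and on the number of vertices (`mulSum_corTable`); the additive one depends on these as well
(`addSum_corTable`). Commute times enter only through their sum over the edges, which Foster's
identity evaluates (`sum_edgeCommute`). Solving from the complete graph gives the formula. -/

noncomputable section

namespace EdgeCorona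

/-! ### Hitting times as solutions of the first-step equations. -/

section Markov

variable {V : Type} [MeasurableSpace V]

/-- The kernels `(x₀, …, xₙ) ↦ κ xₙ` of the homogeneous Markov chain with transition kernel `κ`. -/
abbrev chainKernel (κ : Kernel V V) (n : ℕ) : Kernel ((_k : Finset.Iic n) → V) V :=
  κ.comap (fun x => x ⟨n, Finset.mem_Iic.2 le_rfl⟩) (measurable_pi_apply _)

open Classical in
/-- The probability that the chain with transition probabilities `p` started at `i` does not visit
`j` up to time `n`. -/
def survival {V : Type} [Fintype V] (p : V → PMF V) (j : V) : ℕ → V → ℝ≥0∞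
  | 0, i => if i = j then 0 else 1
  | n + 1, i => if i = j then 0 else ∑ k, p i k * survival p j n k

lemma measurableSet_avoid [DiscreteMeasurableSpace V] (j : V) (a b : ℕ) :
    MeasurableSet {ω : ℕ → V | ∀ k, a ≤ k → k ≤ b → ω k ≠ j} := by
  have : {ω : ℕ → V | ∀ k, a ≤ k → k ≤ b → ω k ≠ j}
      = ⋂ k, ⋂ (_ : a ≤ k), ⋂ (_ : k ≤ b), (fun ω : ℕ → V => ω k) ⁻¹' {j}ᶜ := by
    ext ω; simp
  rw [this]
  exact MeasurableSet.iInter fun k => MeasurableSet.iInter fun _ => MeasurableSet.iInter fun _ =>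
    measurable_pi_apply k (MeasurableSet.of_discrete)

/-- The trajectory kernel from time `a` keeps the given past, so an integrand may be evaluated with
its first coordinates overwritten by `y`. -/
lemma traj_congr_of_past (κ : Kernel V V) [IsMarkovKernel κ] (a : ℕ)
    (y : (_k : Finset.Iic a) → V) {S S' : Set (ℕ → V)} (hS : MeasurableSet S)
    (hS' : MeasurableSet S')
    (h : ∀ ω : ℕ → V, (∀ k : Finset.Iic a, ω k = y k) → (ω ∈ S ↔ ω ∈ S')) :
    Kernel.traj (X := fun _ => V) (chainKernel κ) a y S
      = Kernel.traj (X := fun _ => V) (chainKernel κ) a y S' := by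
  rw [← lintegral_indicator_one hS, ← lintegral_indicator_one hS',
    Kernel.lintegral_traj y (measurable_one.indicator hS),
    Kernel.lintegral_traj y (measurable_one.indicator hS')]
  refine lintegral_congr fun ω => ?_
  have := h (Function.updateFinset ω (Finset.Iic a) y) (fun k => by
    simp [Function.updateFinset])
  by_cases h1 : Function.updateFinset ω (Finset.Iic a) y ∈ S
  · rw [Set.indicator_of_mem h1, Set.indicator_of_mem (this.1 h1)]
  · rw [Set.indicator_of_notMem h1, Set.indicator_of_notMem (fun h2 => h1 (this.2 h2))]

/-- The Markov property: quantifying over every starting time `a` lets the induction restart the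
chain at `a + 1` after one jump, with no time shift of trajectories. -/
lemma traj_avoid [Fintype V] [DiscreteMeasurableSpace V] (κ : Kernel V V) [IsMarkovKernel κ] (p : V → PMF V)
    (hp : ∀ v, κ v = (p v).toMeasure) (j : V) (n : ℕ) :
    ∀ (a : ℕ) (x : (_k : Finset.Iic a) → V),
      Kernel.traj (X := fun _ => V) (chainKernel κ) a x {ω | ∀ k, a ≤ k → k ≤ a + n → ω k ≠ j}
        = survival p j n (x ⟨a, Finset.mem_Iic.2 le_rfl⟩) := by
  classical
  induction n with
  | zero =>
    intro a x
    by_cases hx : x ⟨a, Finset.mem_Iic.2 le_rfl⟩ = j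
    · rw [traj_congr_of_past κ a x (S' := ∅) (measurableSet_avoid j _ _) MeasurableSet.empty]
      · simp [survival, hx]
      · intro ω hω
        have := hω ⟨a, Finset.mem_Iic.2 le_rfl⟩
        simp only [Set.mem_ofPred_eq, Set.mem_empty_iff_false, iff_false]
        intro h
        exact h a le_rfl le_rfl (this.trans hx)
    · rw [traj_congr_of_past κ a x (S' := Set.univ) (measurableSet_avoid j _ _) MeasurableSet.univ]
      · simp [survival, hx]
      · intro ω hω
        have := hω ⟨a, Finset.mem_Iic.2 le_rfl⟩
        simp only [Set.mem_ofPred_eq, Set.mem_univ, iff_true]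
        intro k h1 h2
        obtain rfl : k = a := by omega
        exact fun h => hx (this.symm.trans h)
  | succ n ih =>
    intro a x
    by_cases hx : x ⟨a, Finset.mem_Iic.2 le_rfl⟩ = j
    · rw [traj_congr_of_past κ a x (S' := ∅) (measurableSet_avoid j _ _) MeasurableSet.empty]
      · simp [survival, hx]
      · intro ω hω
        have := hω ⟨a, Finset.mem_Iic.2 le_rfl⟩
        simp only [Set.mem_ofPred_eq, Set.mem_empty_iff_false, iff_false]
        intro h
        exact h a le_rfl (by omega) (this.trans hx)
    · rw [traj_congr_of_past κ a x (S' := {ω | ∀ k, a + 1 ≤ k → k ≤ (a + 1) + n → ω k ≠ j})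
        (measurableSet_avoid j _ _) (measurableSet_avoid j _ _)]
      · rw [← Kernel.traj_comp_partialTraj (Nat.le_succ a),
          Kernel.comp_apply' _ _ _ (measurableSet_avoid j _ _)]
        simp_rw [Nat.succ_eq_add_one, ih (a + 1)]
        rw [← lintegral_map (μ := Kernel.partialTraj (X := fun _ => V) (chainKernel κ) a (a + 1) x)
            (f := survival p j n)
            (g := fun y : (_k : Finset.Iic (a + 1)) → V => y ⟨a + 1, Finset.mem_Iic.2 le_rfl⟩)
            (measurable_of_finite _) (measurable_pi_apply _),
          ← Kernel.map_apply _ (measurable_pi_apply _), Kernel.map_partialTraj_succ_self,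
          Kernel.comap_apply, hp, lintegral_fintype]
        simp only [survival, hx, if_false]
        refine Finset.sum_congr rfl fun k _ => ?_
        rw [PMF.toMeasure_apply_singleton _ _ (MeasurableSet.of_discrete), mul_comm]
      · intro ω hω
        have := hω ⟨a, Finset.mem_Iic.2 le_rfl⟩
        simp only [Set.mem_ofPred_eq]
        constructor
        · intro h k h1 h2
          exact h k (by omega) (by omega)
        · intro h k h1 h2
          rcases h1.eq_or_lt with rfl | h1
          · exact fun h => hx (this.symm.trans h)
          · exact h k (by omega) (by omega)

end Markov

lemma natCast_lt_firstHit {V : Type} (j : V) (ω : ℕ → V) (n : ℕ) :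
    (n : ℕ∞) < firstHit j ω ↔ ∀ k ≤ n, ω k ≠ j := by
  classical
  unfold firstHit
  rw [hittingAfter_def]
  simp only [zero_le, true_and, Set.mem_singleton_iff]
  split_ifs with h
  · have hne : {i : ℕ | ω i = j}.Nonempty := h
    change ((n : ℕ∞) < ((sInf {i : ℕ | ω i = j} : ℕ) : ℕ∞)) ↔ _
    rw [Nat.cast_lt]
    constructor
    · intro h1 k hk hj
      exact absurd (Nat.sInf_le (show k ∈ {i : ℕ | ω i = j} from hj)) (by omega)
    · intro h1
      by_contra h2
      exact h1 _ (not_lt.1 h2) (Nat.sInf_mem hne)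
  · push Not at h
    simp only [h, ne_eq, not_false_eq_true, implies_true, iff_true]
    exact ENat.natCast_lt_top n

lemma enat_toENNReal_eq_tsum (t : ℕ∞) :
    (t : ℝ≥0∞) = ∑' n : ℕ, if (n : ℕ∞) < t then 1 else 0 := by
  classical
  induction t using ENat.recTopCoe with
  | top => simp
  | coe t =>
    rw [tsum_eq_sum (s := Finset.range t)]
    · rw [Finset.sum_congr rfl (g := fun _ => (1 : ℝ≥0∞))]
      · simp
      · intro k hk
        simp [Finset.mem_range.1 hk]
    · intro k hk
      simp only [Finset.mem_range] at hk
      simp [hk]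

/-- The tail-sum formula: the expectation is the sum over `n` of the probability that the first hit
comes after time `n`. -/
lemma hittingTime_eq_tsum {V : Type} [Fintype V] (G : SimpleGraph V) (i j : V) :
    hittingTime G i j = ∑' n, survival (step G) j n i := by
  classical
  let : MeasurableSpace V := ⊤
  have : DiscreteMeasurableSpace V := ⟨fun _ => trivial⟩
  unfold hittingTime
  have hm : ∀ n : ℕ, MeasurableSet {ω : ℕ → V | ∀ k ≤ n, ω k ≠ j} := fun n => by
    simpa using measurableSet_avoid j 0 n
  have h1 : ∀ ω : ℕ → V, ((firstHit j ω : ℕ∞) : ℝ≥0∞)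
      = ∑' n : ℕ, Set.indicator {ω : ℕ → V | ∀ k ≤ n, ω k ≠ j} 1 ω := by
    intro ω
    rw [enat_toENNReal_eq_tsum]
    refine tsum_congr fun n => ?_
    simp only [natCast_lt_firstHit, Set.indicator_apply, Set.mem_ofPred_eq, Pi.one_apply]
  simp_rw [h1]
  rw [lintegral_tsum fun n => (measurable_one.indicator (hm n)).aemeasurable]
  refine tsum_congr fun n => ?_
  rw [lintegral_indicator_one (hm n)]
  have := traj_avoid (walkKernel G) (step G) (fun v => rfl) j n 0 (fun _ => i)
  simp only [zero_le, zero_add, true_imp_iff] at this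
  exact this

/-- The partial sums of survival probabilities iterate the first-step equation from `0`, hence stay
below `h`. Iterating from the constant `C`, which dominates `h`, gives the reverse bound up to `C`
times a survival probability. That error tends to `0` because the series converges, so no
connectedness is needed. -/
lemma tsum_survival_eq {V : Type} [Fintype V] (p : V → PMF V) (j : V) (h : V → ℝ≥0∞)
    (hfin : ∀ i, h i ≠ ⊤) (hj : h j = 0) (heq : ∀ i, i ≠ j → h i = 1 + ∑ k, p i k * h k) (i : V) :
    ∑' n, survival p j n i = h i := by
  classical
  have hle : ∀ n i, ∑ k ∈ Finset.range n, survival p j k i ≤ h i := by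
    intro n
    induction n with
    | zero => simp
    | succ n ih =>
      intro i
      rw [Finset.sum_range_succ']
      by_cases hi : i = j
      · simp [survival, hi]
      · simp only [survival, hi, if_false]
        rw [heq i hi, Finset.sum_comm, add_comm]
        gcongr with k
        rw [← Finset.mul_sum]
        gcongr
        exact ih k
  have hsum : ∀ i, ∑' n, survival p j n i ≤ h i := fun i =>
    ENNReal.tsum_le_of_sum_range_le (fun n => hle n i)
  set C : ℝ≥0∞ := ∑ k, h k with hC
  have hCtop : C ≠ ⊤ := by simp [hC, hfin]
  have hge : ∀ n i, h i ≤ ∑ k ∈ Finset.range n, survival p j k i + C * survival p j n i := by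
    intro n
    induction n with
    | zero =>
      intro i
      by_cases hi : i = j
      · simp [hi, hj]
      · simp only [Finset.range_zero, Finset.sum_empty, survival, hi, if_false, zero_add, mul_one]
        exact Finset.single_le_sum (f := h) (fun _ _ => zero_le) (Finset.mem_univ i)
    | succ n ih =>
      intro i
      by_cases hi : i = j
      · simp [hi, hj]
      rw [Finset.sum_range_succ', heq i hi]
      simp only [survival, hi, if_false]
      calc 1 + ∑ k, p i k * h k
          ≤ 1 + ∑ k, p i k * (∑ l ∈ Finset.range n, survival p j l k + C * survival p j n k) := by
            gcongr with k; exact ih k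
        _ = _ := by
            simp only [mul_add, Finset.sum_add_distrib, Finset.mul_sum]
            rw [Finset.sum_comm]
            simp only [mul_left_comm C]
            ring
  refine le_antisymm (hsum i) ?_
  have hne : ∑' n, survival p j n i ≠ ⊤ := ne_top_of_le_ne_top (hfin i) (hsum i)
  have h0 := ENNReal.tendsto_atTop_zero_of_tsum_ne_top hne
  have h1 : Filter.Tendsto (fun n => ∑' n, survival p j n i + C * survival p j n i) Filter.atTop
      (nhds (∑' n, survival p j n i + C * 0)) :=
    tendsto_const_nhds.add (ENNReal.Tendsto.const_mul h0 (Or.inr hCtop))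
  rw [mul_zero, add_zero] at h1
  refine ge_of_tendsto' h1 fun n => (hge n i).trans ?_
  gcongr
  exact ENNReal.sum_le_tsum _

open Classical in
/-- A nonnegative solution of the first-step equations for the target `j` consists of the hitting
times of `j`. -/
theorem hittingTime_eq_ofReal {V : Type} [Fintype V] (G : SimpleGraph V)
    (hG : ∀ i, (G.neighborFinset i).Nonempty) (j : V) (h : V → ℝ) (h0 : ∀ i, 0 ≤ h i)
    (hj : h j = 0)
    (heq : ∀ i, i ≠ j → (G.degree i : ℝ) * h i = G.degree i + ∑ k ∈ G.neighborFinset i, h k)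
    (i : V) : hittingTime G i j = ENNReal.ofReal (h i) := by
  rw [hittingTime_eq_tsum]
  refine tsum_survival_eq (step G) j (fun i => ENNReal.ofReal (h i)) (fun _ => ENNReal.ofReal_ne_top)
    (by simp [hj]) (fun i hi => ?_) i
  have hd : (0 : ℝ) < G.degree i := by
    rw [← G.card_neighborFinset_eq_degree]
    exact_mod_cast Finset.card_pos.2 (hG i)
  have h1 : h i = 1 + ∑ k ∈ G.neighborFinset i, (G.degree i : ℝ)⁻¹ * h k := by
    rw [← Finset.mul_sum]
    have := heq i hi
    field_simp
    linarith
  rw [h1, ENNReal.ofReal_add zero_le_one (Finset.sum_nonneg fun k _ =>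
      mul_nonneg (inv_nonneg.2 hd.le) (h0 k)), ENNReal.ofReal_one,
    ENNReal.ofReal_sum_of_nonneg fun k _ => mul_nonneg (inv_nonneg.2 hd.le) (h0 k)]
  congr 1
  rw [← Finset.sum_subset (Finset.subset_univ (G.neighborFinset i))]
  · refine Finset.sum_congr rfl fun k hk => ?_
    rw [ENNReal.ofReal_mul (inv_nonneg.2 hd.le), step, dif_pos (hG i),
      PMF.uniformOfFinset_apply_of_mem _ hk, ENNReal.ofReal_inv_of_pos hd,
      G.card_neighborFinset_eq_degree, ENNReal.ofReal_natCast]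
  · intro k _ hk
    rw [step, dif_pos (hG i), PMF.uniformOfFinset_apply_of_notMem _ hk, zero_mul]

/-! ### Laplacians, the edge corona and its table of hitting times. -/

section Table

open Classical

variable {V : Type}

lemma edgeCorona_adj_inl_inl (q : ℕ) (G : SimpleGraph V) (u v : V) :
    (edgeCorona q G).Adj (Sum.inl u) (Sum.inl v) ↔ G.Adj u v := Iff.rfl

lemma edgeCorona_adj_inl_inr (q : ℕ) (G : SimpleGraph V) (u : V) (e : G.edgeSet) (a : Fin q) :
    (edgeCorona q G).Adj (Sum.inl u) (Sum.inr (e, a)) ↔ u ∈ (e : Sym2 V) := Iff.rfl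

lemma edgeCorona_adj_inr_inl (q : ℕ) (G : SimpleGraph V) (u : V) (e : G.edgeSet) (a : Fin q) :
    (edgeCorona q G).Adj (Sum.inr (e, a)) (Sum.inl u) ↔ u ∈ (e : Sym2 V) := Iff.rfl

lemma edgeCorona_adj_inr_inr (q : ℕ) (G : SimpleGraph V) (e f : G.edgeSet) (a b : Fin q) :
    (edgeCorona q G).Adj (Sum.inr (e, a)) (Sum.inr (f, b)) ↔ e = f ∧ a ≠ b := Iff.rfl

variable [Fintype V]

/-- The sum of `f` over the neighbours of `i`. -/
def nbrSum (G : SimpleGraph V) (f : V → ℝ) (i : V) : ℝ := ∑ k, if G.Adj i k then f k else 0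

/-- The degree as a real number. -/
def deg (G : SimpleGraph V) (i : V) : ℝ := nbrSum G (fun _ => 1) i

/-- The degree sum of the graph, twice its number of edges. -/
def degSum (G : SimpleGraph V) : ℝ := ∑ i, deg G i

/-- The graph Laplacian. -/
def lap (G : SimpleGraph V) (f : V → ℝ) (i : V) : ℝ := deg G i * f i - nbrSum G f i

/-- The sum of `f` over the ends of `e`. -/
def endSum (f : V → ℝ) (e : Sym2 V) : ℝ := ∑ u, if u ∈ e then f u else 0

lemma nbrSum_add (G : SimpleGraph V) (f g : V → ℝ) (i : V) :
    nbrSum G (fun k => f k + g k) i = nbrSum G f i + nbrSum G g i := by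
  simp only [nbrSum, ← Finset.sum_add_distrib]
  exact Finset.sum_congr rfl fun k _ => by split_ifs <;> simp

lemma nbrSum_mul_left (G : SimpleGraph V) (c : ℝ) (f : V → ℝ) (i : V) :
    nbrSum G (fun k => c * f k) i = c * nbrSum G f i := by
  simp only [nbrSum, Finset.mul_sum]
  exact Finset.sum_congr rfl fun k _ => by split_ifs <;> simp

lemma nbrSum_const (G : SimpleGraph V) (c : ℝ) (i : V) :
    nbrSum G (fun _ => c) i = c * deg G i := by
  rw [deg, ← nbrSum_mul_left]; simp

lemma nbrSum_congr (G : SimpleGraph V) {f g : V → ℝ} {i : V} (h : ∀ k, G.Adj i k → f k = g k) :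
    nbrSum G f i = nbrSum G g i :=
  Finset.sum_congr rfl fun k _ => by
    by_cases hk : G.Adj i k
    · simp [hk, h k hk]
    · simp [hk]

lemma deg_nonneg (G : SimpleGraph V) (i : V) : 0 ≤ deg G i :=
  Finset.sum_nonneg fun k _ => by split_ifs <;> norm_num

lemma one_le_degSum {G : SimpleGraph V} {u v : V} (h : G.Adj u v) : 1 ≤ degSum G := by
  have h1 : (1 : ℝ) ≤ deg G u := by
    have := Finset.single_le_sum (f := fun k => if G.Adj u k then (1 : ℝ) else 0)
      (fun k _ => by split_ifs <;> norm_num) (Finset.mem_univ v)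
    rwa [if_pos h] at this
  exact h1.trans (Finset.single_le_sum (fun k _ => deg_nonneg G k) (Finset.mem_univ u))

lemma lap_add (G : SimpleGraph V) (f g : V → ℝ) (i : V) :
    lap G (fun k => f k + g k) i = lap G f i + lap G g i := by
  simp only [lap, nbrSum_add]; ring

lemma lap_mul_left (G : SimpleGraph V) (c : ℝ) (f : V → ℝ) (i : V) :
    lap G (fun k => c * f k) i = c * lap G f i := by
  simp only [lap, nbrSum_mul_left]; ring

lemma lap_const (G : SimpleGraph V) (c : ℝ) (i : V) : lap G (fun _ => c) i = 0 := by
  simp only [lap, nbrSum_const]; ring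

lemma endSum_mk {f : V → ℝ} {u v : V} (h : u ≠ v) : endSum f s(u, v) = f u + f v := by
  have : ∀ w, (if w ∈ s(u, v) then f w else 0)
      = (if w = u then f w else 0) + (if w = v then f w else 0) := by
    intro w
    by_cases h1 : w = u
    · subst h1; simp [h]
    · by_cases h2 : w = v
      · subst h2; simp [h1]
      · simp [h1, h2]
  simp only [endSum, this, Finset.sum_add_distrib, Finset.sum_ite_eq', Finset.mem_univ, if_true]

lemma endSum_add (f g : V → ℝ) (e : Sym2 V) :
    endSum (fun k => f k + g k) e = endSum f e + endSum g e := by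
  simp only [endSum, ← Finset.sum_add_distrib]
  exact Finset.sum_congr rfl fun k _ => by split_ifs <;> simp

lemma endSum_mul_left (c : ℝ) (f : V → ℝ) (e : Sym2 V) :
    endSum (fun k => c * f k) e = c * endSum f e := by
  simp only [endSum, Finset.mul_sum]
  exact Finset.sum_congr rfl fun k _ => by split_ifs <;> simp

lemma endSum_const {G : SimpleGraph V} (c : ℝ) (e : G.edgeSet) :
    endSum (fun _ : V => c) (e : Sym2 V) = 2 * c := by
  obtain ⟨e, he⟩ := e
  induction e with | _ u v => rw [endSum_mk (G.ne_of_adj he)]; ring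

lemma endSum_nonneg {f : V → ℝ} (h : ∀ i, 0 ≤ f i) (e : Sym2 V) : 0 ≤ endSum f e :=
  Finset.sum_nonneg fun k _ => by split_ifs <;> simp [h]

lemma sum_endSum {ι : Type} (s : Finset ι) (F : ι → V → ℝ) (e : Sym2 V) :
    ∑ k ∈ s, endSum (F k) e = endSum (fun u => ∑ k ∈ s, F k u) e := by
  simp only [endSum]
  rw [Finset.sum_comm]
  exact Finset.sum_congr rfl fun k _ => by split_ifs <;> simp

lemma lap_endSum (G : SimpleGraph V) (F : V → V → ℝ) (e : Sym2 V) (i : V) :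
    lap G (fun k => endSum (F k) e) i = endSum (fun u => lap G (fun k => F k u) i) e := by
  simp only [lap, nbrSum, endSum]
  have h1 : ∀ k, (if G.Adj i k then (∑ u, if u ∈ e then F k u else 0) else 0)
      = ∑ u, if u ∈ e then (if G.Adj i k then F k u else 0) else 0 := by
    intro k
    split_ifs <;> simp
  simp only [h1]
  rw [Finset.sum_comm, Finset.mul_sum, ← Finset.sum_sub_distrib]
  exact Finset.sum_congr rfl fun u _ => by split_ifs <;> simp

lemma sum_incident (G : SimpleGraph V) (u : V) (ψ : Sym2 V → ℝ) :
    ∑ e : G.edgeSet, (if u ∈ (e : Sym2 V) then ψ e else 0) = nbrSum G (fun k => ψ s(u, k)) u := by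
  rw [nbrSum, ← Finset.sum_filter, ← Finset.sum_filter]
  symm
  refine Finset.sum_bij (fun k hk => ⟨s(u, k), (Finset.mem_filter.1 hk).2⟩) ?_ ?_ ?_ ?_
  · intro k hk
    simp
  · intro k _ l _ h
    exact Sym2.congr_right.1 (congrArg Subtype.val h)
  · rintro ⟨e, he⟩ h
    have hu : u ∈ e := (Finset.mem_filter.1 h).2
    obtain ⟨v, rfl⟩ := hu
    exact ⟨v, by simpa using he, rfl⟩
  · intro k _
    rfl

/-- Double counting of incident vertex-edge pairs; this turns sums over the new cliques into sums
over old vertices. -/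
lemma sum_edge_endSum (G : SimpleGraph V) (ψ : V → Sym2 V → ℝ) :
    ∑ e : G.edgeSet, endSum (fun u => ψ u e) (e : Sym2 V)
      = ∑ u, nbrSum G (fun k => ψ u s(u, k)) u := by
  simp only [endSum]
  rw [Finset.sum_comm]
  exact Finset.sum_congr rfl fun u _ => sum_incident G u (ψ u)

lemma sum_edge_endSum_const (G : SimpleGraph V) (f : V → ℝ) :
    ∑ e : G.edgeSet, endSum f (e : Sym2 V) = ∑ u, deg G u * f u := by
  rw [sum_edge_endSum G (fun u _ => f u)]
  simp only [nbrSum_const, mul_comm]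

lemma two_mul_card_edgeSet (G : SimpleGraph V) :
    2 * (Fintype.card G.edgeSet : ℝ) = degSum G := by
  have := sum_edge_endSum_const G (fun _ => 1)
  simp only [endSum_const, mul_one] at this
  rw [degSum, ← this]
  simp [mul_comm]

/-! ### Sums over the edge corona -/

variable (q : ℕ) (G : SimpleGraph V)

lemma nbrSum_inl (f : V ⊕ (G.edgeSet × Fin q) → ℝ) (u : V) :
    nbrSum (edgeCorona q G) f (Sum.inl u) = nbrSum G (fun k => f (Sum.inl k)) u
      + ∑ e : G.edgeSet, if u ∈ (e : Sym2 V) then ∑ a, f (Sum.inr (e, a)) else 0 := by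
  simp only [nbrSum, Fintype.sum_sum_type, Fintype.sum_prod_type, edgeCorona_adj_inl_inl,
    edgeCorona_adj_inl_inr]
  congr 1
  exact Finset.sum_congr rfl fun e _ => by split_ifs <;> simp

lemma nbrSum_inr (f : V ⊕ (G.edgeSet × Fin q) → ℝ) (e : G.edgeSet) (a : Fin q) :
    nbrSum (edgeCorona q G) f (Sum.inr (e, a)) = endSum (fun k => f (Sum.inl k)) (e : Sym2 V)
      + (∑ b, f (Sum.inr (e, b)) - f (Sum.inr (e, a))) := by
  simp only [nbrSum, Fintype.sum_sum_type, Fintype.sum_prod_type, edgeCorona_adj_inr_inl,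
    edgeCorona_adj_inr_inr, endSum]
  congr 1
  rw [Finset.sum_eq_single e]
  · rw [← Finset.sum_erase_eq_sub (Finset.mem_univ a), ← Finset.sum_filter]
    refine Finset.sum_congr ?_ fun _ _ => rfl
    ext b; simp [eq_comm]
  · intro f' _ hf
    simp [Ne.symm hf]
  · simp

lemma deg_inl (u : V) : deg (edgeCorona q G) (Sum.inl u) = (q + 1) * deg G u := by
  rw [deg, nbrSum_inl, sum_incident G u (fun _ => ∑ _a : Fin q, 1), nbrSum_const, nbrSum_const]
  simp only [Finset.sum_const, Finset.card_univ, Fintype.card_fin, nsmul_eq_mul, mul_one]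
  ring

lemma deg_inr (x : G.edgeSet × Fin q) : deg (edgeCorona q G) (Sum.inr x) = q + 1 := by
  obtain ⟨e, a⟩ := x
  rw [deg, nbrSum_inr, endSum_const]
  simp only [Finset.sum_const, Finset.card_univ, Fintype.card_fin, nsmul_eq_mul, mul_one]
  ring

lemma degSum_edgeCorona :
    degSum (edgeCorona q G) = (q + 1) * (q + 2) / 2 * degSum G := by
  have := two_mul_card_edgeSet G
  rw [degSum, Fintype.sum_sum_type, Fintype.sum_prod_type]
  simp only [deg_inl, deg_inr, ← Finset.mul_sum, Finset.sum_const, Finset.card_univ,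
    Fintype.card_fin, nsmul_eq_mul]
  rw [← degSum]
  linear_combination (q * (q + 1) / 2 : ℝ) * this

lemma card_edgeCorona :
    (Fintype.card (V ⊕ (G.edgeSet × Fin q)) : ℝ) = Fintype.card V + q * degSum G / 2 := by
  have := two_mul_card_edgeSet G
  simp only [Fintype.card_sum, Fintype.card_prod, Fintype.card_fin, Nat.cast_add, Nat.cast_mul]
  linear_combination (q / 2 : ℝ) * this

/-- The extension of `(q + 1) g` to the edge corona that solves the first-step equations of the walk
at all new vertices. -/
def corExt (g : V → ℝ) : V ⊕ (G.edgeSet × Fin q) → ℝ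
  | Sum.inl k => (q + 1) * g k
  | Sum.inr (e, _) => (q + 1) * (1 / 2 + 1 / 2 * endSum g (e : Sym2 V))

lemma lap_corExt_inl (g : V → ℝ) (u : V) :
    lap (edgeCorona q G) (corExt q G g) (Sum.inl u)
      = (q + 1) * ((1 + q / 2) * lap G g u - q / 2 * deg G u) := by
  rw [lap, nbrSum_inl, deg_inl]
  simp only [corExt]
  rw [sum_incident G u
      (fun e => ∑ _a : Fin q, ((q : ℝ) + 1) * (1 / 2 + 1 / 2 * endSum g e)),
    nbrSum_congr G (f := fun k => ∑ _a : Fin q, _) (g := fun k => (q * (q + 1) / 2 * (1 + g u) : ℝ) + (q * (q + 1) / 2) * g k),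
    nbrSum_add, nbrSum_const, nbrSum_mul_left, nbrSum_mul_left, lap]
  · ring
  · intro k hk
    simp only [endSum_mk (G.ne_of_adj hk), Finset.sum_const, Finset.card_univ, Fintype.card_fin,
      nsmul_eq_mul]
    ring

/-- Each jump from a new vertex leaves its clique with probability `2 / (q + 1)`, to either end
equally likely: this is the mean exit time `(q + 1) / 2` plus the average of the end values in
`corExt`. -/
lemma lap_corExt_inr (g : V → ℝ) (x : G.edgeSet × Fin q) :
    lap (edgeCorona q G) (corExt q G g) (Sum.inr x) = q + 1 := by
  obtain ⟨e, a⟩ := x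
  rw [lap, nbrSum_inr, deg_inr]
  simp only [corExt, endSum_mul_left, Finset.sum_const, Finset.card_univ, Fintype.card_fin,
      nsmul_eq_mul]
  ring

lemma sum_corExt (g : V → ℝ) :
    ∑ x, corExt q G g x
      = (q + 1) * (∑ k, g k + q * (degSum G / 4 + 1 / 2 * ∑ k, deg G k * g k)) := by
  rw [Fintype.sum_sum_type, Fintype.sum_prod_type, ← sum_edge_endSum_const,
    ← two_mul_card_edgeSet G]
  simp only [corExt, Finset.sum_const, Finset.card_univ, Fintype.card_fin, nsmul_eq_mul,
    ← Finset.mul_sum, Finset.sum_add_distrib]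
  ring

lemma sum_deg_mul_corExt (g : V → ℝ) :
    ∑ x, deg (edgeCorona q G) x * corExt q G g x
      = (q + 1) ^ 2 * (∑ k, deg G k * g k
          + q * (degSum G / 4 + 1 / 2 * ∑ k, deg G k * g k)) := by
  rw [Fintype.sum_sum_type, Fintype.sum_prod_type]
  nth_rw 2 [← sum_edge_endSum_const]
  rw [← two_mul_card_edgeSet G]
  simp only [corExt, deg_inl, deg_inr, Finset.sum_const, Finset.card_univ, Fintype.card_fin,
    nsmul_eq_mul, ← Finset.mul_sum, Finset.sum_add_distrib, mul_assoc, mul_left_comm (deg G _)]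
  ring

/-- A function supported on the new clique over `e`, peaked at its vertex `a`. -/
def bump (e : G.edgeSet) (a : Fin q) : V ⊕ (G.edgeSet × Fin q) → ℝ
  | Sum.inl _ => 0
  | Sum.inr (f, b) => if f = e then 1 / 2 + (if b = a then 1 else 0) else 0

variable {q G}

lemma sum_bump_clique {V : Type} {G : SimpleGraph V} (e f : G.edgeSet) (a : Fin q) :
    ∑ b, bump q G e a (Sum.inr (f, b)) = if f = e then (q : ℝ) / 2 + 1 else 0 := by
  by_cases h : f = e
  · simp [bump, h, Finset.sum_add_distrib]; ring
  · simp [bump, h]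

/-- `bump` is the electric potential of a current `q + 2` that enters at `a` and leaves in equal
halves at the two grounded ends of `e`. -/
lemma lap_bump_inl (e : G.edgeSet) (a : Fin q) (u : V) :
    lap (edgeCorona q G) (bump q G e a) (Sum.inl u)
      = -(if u ∈ (e : Sym2 V) then (q : ℝ) / 2 + 1 else 0) := by
  rw [lap, nbrSum_inl]
  simp only [sum_bump_clique]
  rw [Finset.sum_eq_single e]
  · simp [bump, nbrSum]
  · intro f _ hf
    simp [hf]
  · simp

lemma lap_bump_inr (e : G.edgeSet) (a : Fin q) (x : G.edgeSet × Fin q) :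
    lap (edgeCorona q G) (bump q G e a) (Sum.inr x)
      = if x = (e, a) then (q : ℝ) + 2 else 0 := by
  obtain ⟨f, b⟩ := x
  rw [lap, nbrSum_inr, deg_inr, sum_bump_clique]
  by_cases h : f = e
  · by_cases hb : b = a
    · simp [bump, h, hb, endSum]; ring
    · simp [bump, h, hb, endSum]; ring
  · simp [bump, h, endSum]

lemma sum_bump (e : G.edgeSet) (a : Fin q) : ∑ x, bump q G e a x = (q : ℝ) / 2 + 1 := by
  rw [Fintype.sum_sum_type, Fintype.sum_prod_type]
  simp only [sum_bump_clique]
  simp [bump]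

lemma sum_deg_mul_bump (e : G.edgeSet) (a : Fin q) :
    ∑ x, deg (edgeCorona q G) x * bump q G e a x = (q + 1) * ((q : ℝ) / 2 + 1) := by
  rw [Fintype.sum_sum_type, Fintype.sum_prod_type]
  simp only [deg_inr, ← Finset.mul_sum, sum_bump_clique]
  simp [bump]

/-! ### The recursion for tables of hitting times -/

/-- `T` solves the equations that characterise hitting times, and the commute time between
adjacent vertices is at most the degree sum. -/
structure IsHittingTable (G : SimpleGraph V) (T : V → V → ℝ) : Prop where
  self : ∀ j, T j j = 0
  nonneg : ∀ i j, 0 ≤ T i j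
  lap_eq : ∀ i j, lap G (fun k => T k j) i = deg G i - if i = j then degSum G else 0
  commute_le : ∀ i j, G.Adj i j → T i j + T j i ≤ degSum G

/-- The commute time between the ends of `e`. -/
def edgeCommute (T : V → V → ℝ) (e : Sym2 V) : ℝ := endSum (fun u => endSum (T u) e) e

variable (G) in
/-- Up to the factor `q + 1`, the hitting time in the edge corona of a new vertex over `e` from the
old vertex `k`. -/
def newTarget (T : V → V → ℝ) (e : Sym2 V) (k : V) : ℝ :=
  1 / 2 * endSum (T k) e + ((3 * degSum G / 2 - 1) / 2 - edgeCommute T e / 4)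

variable (q G) in
/-- The table of hitting times of the edge corona, in terms of that of the graph. -/
def corTable (T : V → V → ℝ) (x : V ⊕ (G.edgeSet × Fin q)) : V ⊕ (G.edgeSet × Fin q) → ℝ
  | Sum.inl j => corExt q G (fun k => T k j) x
  | Sum.inr (e, a) =>
      corExt q G (newTarget G T e) x + (-((q + 1) * degSum G / 2)) * bump q G e a x

lemma edgeCommute_mk {T : V → V → ℝ} (hT : IsHittingTable G T) {u v : V} (h : u ≠ v) :
    edgeCommute T s(u, v) = T u v + T v u := by
  simp only [edgeCommute, endSum_mk h, hT.self]; ring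

/-- The constant in `newTarget` is fixed by this: `corExt` then equals `3 (q + 1) D / 4` on the
clique over `e`, with `D` the degree sum, and the `bump` term, with value `3 / 2` at the target,
cancels it there. -/
lemma endSum_newTarget (T : V → V → ℝ) (e : G.edgeSet) :
    endSum (newTarget G T e) (e : Sym2 V) = 3 * degSum G / 2 - 1 := by
  unfold newTarget
  rw [endSum_add, endSum_const, endSum_mul_left, ← edgeCommute]
  ring

lemma edgeCommute_le {T : V → V → ℝ} (hT : IsHittingTable G T) (e : G.edgeSet) :
    edgeCommute T e ≤ degSum G := by
  obtain ⟨e, he⟩ := e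
  induction e with | _ u v =>
    rw [edgeCommute_mk hT (G.ne_of_adj he)]
    exact hT.commute_le _ _ he

lemma one_le_degSum_of_edge (e : G.edgeSet) : 1 ≤ degSum G := by
  obtain ⟨e, he⟩ := e
  induction e with | _ u v => exact one_le_degSum (G := G) he

/-- The bound on commute times is needed here: the constant is at least `(D - 1) / 2`, with `D` the
degree sum. -/
lemma newTarget_nonneg {T : V → V → ℝ} (hT : IsHittingTable G T) (e : G.edgeSet) (k : V) :
    0 ≤ newTarget G T e k := by
  have h1 := edgeCommute_le hT e
  have h2 := endSum_nonneg (hT.nonneg k) (e : Sym2 V)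
  have h3 := one_le_degSum_of_edge e
  unfold newTarget
  linarith

lemma corExt_nonneg {g : V → ℝ} (hg : ∀ k, 0 ≤ g k) (x : V ⊕ (G.edgeSet × Fin q)) :
    0 ≤ corExt q G g x := by
  rcases x with k | ⟨e, a⟩
  · have := hg k
    simp only [corExt]; positivity
  · have := endSum_nonneg hg (e : Sym2 V)
    simp only [corExt]; positivity

lemma corTable_clique (T : V → V → ℝ) (e : G.edgeSet) (a b : Fin q) :
    corTable q G T (Sum.inr (e, b)) (Sum.inr (e, a))
      = if b = a then 0 else (q + 1) * degSum G / 2 := by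
  simp only [corTable, corExt, endSum_newTarget, bump, if_true]
  split_ifs <;> ring

lemma corTable_commute {T : V → V → ℝ} (hT : IsHittingTable G T) (e : G.edgeSet) (a : Fin q)
    {u : V} (hu : u ∈ (e : Sym2 V)) :
    corTable q G T (Sum.inl u) (Sum.inr (e, a)) + corTable q G T (Sum.inr (e, a)) (Sum.inl u)
      ≤ (q + 1) * degSum G := by
  have h1 := edgeCommute_le hT e
  obtain ⟨e, he⟩ := e
  obtain ⟨v, rfl⟩ := hu
  have hne : u ≠ v := G.ne_of_adj he
  simp only [corTable, corExt, bump, newTarget, edgeCommute_mk hT hne, endSum_mk hne,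
    hT.self] at h1 ⊢
  have : (0 : ℝ) ≤ q + 1 := by positivity
  -- With `c` the commute time between `u` and `v` and `D` the degree sum, the left side is `(q + 1)
  -- (3 D + c) / 4`.
  nlinarith [mul_nonneg this (sub_nonneg.2 h1)]

theorem IsHittingTable.corTable {T : V → V → ℝ} (hT : IsHittingTable G T) :
    IsHittingTable (edgeCorona q G) (corTable q G T) where
  self := by
    rintro (j | ⟨e, a⟩)
    · simp [EdgeCorona.corTable, corExt, hT.self]
    · simp [corTable_clique]
  nonneg := by
    rintro x (j | ⟨e, a⟩)
    · exact corExt_nonneg (fun k => hT.nonneg k j) x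
    · have h1 := one_le_degSum_of_edge e
      have h2 := corExt_nonneg (q := q) (newTarget_nonneg hT e) x
      rcases x with i | ⟨f, b⟩
      · simpa [EdgeCorona.corTable, bump] using h2
      · by_cases hf : f = e
        · subst hf
          rw [corTable_clique]
          split_ifs
          · exact le_rfl
          · positivity
        · simpa [EdgeCorona.corTable, bump, hf] using h2
  lap_eq := by
    rintro x (j | ⟨e, a⟩)
    · simp only [EdgeCorona.corTable]
      rcases x with i | x
      · rw [lap_corExt_inl, hT.lap_eq, deg_inl, degSum_edgeCorona]
        simp only [Sum.inl.injEq]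
        split_ifs <;> ring
      · rw [lap_corExt_inr, deg_inr]
        simp
    · simp only [EdgeCorona.corTable]
      rw [lap_add, lap_mul_left]
      rcases x with i | x
      · have h : lap G (newTarget G T e) i
            = deg G i - 1 / 2 * (if i ∈ (e : Sym2 V) then degSum G else 0) := by
          unfold newTarget
          rw [lap_add, lap_const, lap_mul_left, lap_endSum]
          simp only [hT.lap_eq, sub_eq_add_neg]
          rw [endSum_add, endSum_const]
          have : endSum (fun u => -if i = u then degSum G else 0) (e : Sym2 V)
              = -(if i ∈ (e : Sym2 V) then degSum G else 0) := by
            rw [endSum, Finset.sum_eq_single i]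
            · by_cases hi : i ∈ (e : Sym2 V) <;> simp [hi]
            · intro k _ hk
              simp [Ne.symm hk]
            · simp
          rw [this]; ring
        -- At the ends of `e`, the sinks left by averaging two columns cancel against the current
        -- drawn by `bump`.
        rw [lap_corExt_inl, h, lap_bump_inl, deg_inl]
        simp only [reduceCtorEq, if_false]
        split_ifs <;> ring
      · rw [lap_corExt_inr, lap_bump_inr, deg_inr, degSum_edgeCorona]
        simp only [Sum.inr.injEq]
        split_ifs <;> ring
  commute_le := by
    have hq : ∀ {c : ℝ}, c ≤ (q + 1) * degSum G → 1 ≤ degSum G →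
        c ≤ degSum (edgeCorona q G) := by
      intro c h1 h2
      rw [degSum_edgeCorona]
      have : (0 : ℝ) ≤ q * (q + 1) * degSum G := by positivity
      linarith
    rintro (u | ⟨e, a⟩) (v | ⟨f, b⟩) h
    · have h' : G.Adj u v := h
      refine hq ?_ (one_le_degSum h')
      simp only [EdgeCorona.corTable, corExt]
      rw [← mul_add]
      have := hT.commute_le u v h'
      gcongr
    · exact hq (corTable_commute hT f b h) (one_le_degSum_of_edge f)
    · rw [add_comm]
      exact hq (corTable_commute hT e a h) (one_le_degSum_of_edge e)
    · obtain ⟨rfl, hab⟩ : e = f ∧ a ≠ b := h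
      rw [corTable_clique, corTable_clique, if_neg hab, if_neg hab.symm]
      exact hq (by linarith) (one_le_degSum_of_edge e)

end Table

/-! ### Recursions for the degree-weighted sums. -/

section Sums

open Classical

variable {V : Type} [Fintype V]

/-- The sum `∑ᵢ Tᵢⱼ` of a column of `T`. -/
def colSum (T : V → V → ℝ) (j : V) : ℝ := ∑ i, T i j

/-- The degree-weighted sum `∑ᵢ dᵢ Tᵢⱼ` of a column of `T`. -/
def degColSum (G : SimpleGraph V) (T : V → V → ℝ) (j : V) : ℝ := ∑ i, deg G i * T i j

/-- The additive-degree sum `∑ᵢⱼ (dᵢ + dⱼ) Tᵢⱼ`. -/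
def addSum (G : SimpleGraph V) (T : V → V → ℝ) : ℝ :=
  ∑ j, (degColSum G T j + deg G j * colSum T j)

/-- The multiplicative-degree sum `∑ᵢⱼ dᵢ dⱼ Tᵢⱼ`. -/
def mulSum (G : SimpleGraph V) (T : V → V → ℝ) : ℝ := ∑ j, deg G j * degColSum G T j

variable {G : SimpleGraph V} {T : V → V → ℝ}

/-- The commute times over the edges add up to the degree sum times one less than the number of
vertices. -/
lemma sum_edgeCommute (hT : IsHittingTable G T) :
    ∑ e : G.edgeSet, edgeCommute T (e : Sym2 V) = degSum G * (Fintype.card V - 1) := by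
  simp only [edgeCommute]
  rw [sum_edge_endSum G (fun u e => endSum (T u) e)]
  have h1 : ∀ u, nbrSum G (fun k => endSum (T u) s(u, k)) u = nbrSum G (T u) u := fun u =>
    nbrSum_congr G fun k hk => by rw [endSum_mk (G.ne_of_adj hk), hT.self, zero_add]
  simp only [h1]
  have h2 : ∑ u, nbrSum G (T u) u = ∑ k, nbrSum G (fun u => T u k) k := by
    simp only [nbrSum]
    rw [Finset.sum_comm]
    simp only [G.adj_comm]
  -- The equation at the target itself, where `T k k = 0`: it encodes the mean return time `degSum G
  -- / deg G k`.
  have h3 : ∀ k, nbrSum G (fun u => T u k) k = degSum G - deg G k := fun k => by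
    have := hT.lap_eq k k
    rw [lap, hT.self, if_pos rfl] at this
    linarith
  rw [h2]
  simp only [h3, Finset.sum_sub_distrib, Finset.sum_const, Finset.card_univ, nsmul_eq_mul]
  rw [← degSum]
  ring

lemma colSum_corTable_inl (q : ℕ) (j : V) :
    colSum (corTable q G T) (Sum.inl j)
      = (q + 1) * (colSum T j + q * (degSum G / 4 + 1 / 2 * degColSum G T j)) :=
  sum_corExt q G fun k => T k j

lemma degColSum_corTable_inl (q : ℕ) (j : V) :
    degColSum (edgeCorona q G) (corTable q G T) (Sum.inl j)
      = (q + 1) ^ 2 * (degColSum G T j + q * (degSum G / 4 + 1 / 2 * degColSum G T j)) :=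
  sum_deg_mul_corExt q G fun k => T k j

lemma sum_newTarget (e : G.edgeSet) :
    ∑ k, newTarget G T e k = 1 / 2 * endSum (colSum T) (e : Sym2 V)
      + Fintype.card V * ((3 * degSum G / 2 - 1) / 2 - edgeCommute T e / 4) := by
  simp only [newTarget, Finset.sum_add_distrib, ← Finset.mul_sum, sum_endSum, Finset.sum_const,
    Finset.card_univ, nsmul_eq_mul]
  rfl

lemma sum_deg_mul_newTarget (e : G.edgeSet) :
    ∑ k, deg G k * newTarget G T e k = 1 / 2 * endSum (degColSum G T) (e : Sym2 V)
      + degSum G * ((3 * degSum G / 2 - 1) / 2 - edgeCommute T e / 4) := by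
  simp only [newTarget, mul_add, Finset.sum_add_distrib, mul_left_comm (deg G _),
    ← Finset.mul_sum, ← endSum_mul_left, sum_endSum, ← Finset.sum_mul]
  rfl

lemma colSum_corTable_inr (q : ℕ) (e : G.edgeSet) (a : Fin q) :
    colSum (corTable q G T) (Sum.inr (e, a))
      = (q + 1) * (∑ k, newTarget G T e k
          + q * (degSum G / 4 + 1 / 2 * ∑ k, deg G k * newTarget G T e k)
          - degSum G / 2 * (q / 2 + 1)) := by
  rw [colSum]
  simp only [corTable, Finset.sum_add_distrib, ← Finset.mul_sum, sum_corExt, sum_bump]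
  ring

lemma degColSum_corTable_inr (q : ℕ) (e : G.edgeSet) (a : Fin q) :
    degColSum (edgeCorona q G) (corTable q G T) (Sum.inr (e, a))
      = (q + 1) ^ 2 * (∑ k, deg G k * newTarget G T e k
          + q * (degSum G / 4 + 1 / 2 * ∑ k, deg G k * newTarget G T e k)
          - degSum G / 2 * (q / 2 + 1)) := by
  rw [degColSum]
  simp only [corTable, mul_add, Finset.sum_add_distrib, mul_left_comm (deg _ _),
    ← Finset.mul_sum, sum_deg_mul_corExt, sum_deg_mul_bump]
  ring

lemma sum_edge_sum_newTarget (hT : IsHittingTable G T) :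
    ∑ e : G.edgeSet, ∑ k, newTarget G T e k = 1 / 2 * ∑ j, deg G j * colSum T j
      + Fintype.card V * (degSum G / 2 * ((3 * degSum G / 2 - 1) / 2)
        - degSum G * (Fintype.card V - 1) / 4) := by
  simp only [sum_newTarget, Finset.sum_add_distrib, ← Finset.mul_sum, Finset.sum_sub_distrib,
    ← Finset.sum_div, sum_edge_endSum_const, sum_edgeCommute hT, Finset.sum_const,
    Finset.card_univ, nsmul_eq_mul]
  rw [← two_mul_card_edgeSet G]
  ring

lemma sum_edge_sum_deg_mul_newTarget (hT : IsHittingTable G T) :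
    ∑ e : G.edgeSet, ∑ k, deg G k * newTarget G T e k = 1 / 2 * mulSum G T
      + degSum G * (degSum G / 2 * ((3 * degSum G / 2 - 1) / 2)
        - degSum G * (Fintype.card V - 1) / 4) := by
  simp only [sum_deg_mul_newTarget, Finset.sum_add_distrib, ← Finset.mul_sum,
    Finset.sum_sub_distrib, ← Finset.sum_div, sum_edge_endSum_const, sum_edgeCommute hT,
    Finset.sum_const, Finset.card_univ, nsmul_eq_mul, mulSum]
  rw [← two_mul_card_edgeSet G]
  ring

/-- The homogeneous factor `(q + 1) ^ 3 * (1 + q / 2) ^ 2` is the growth rate `(q + 2) ^ 2 * (q + 1)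
^ 3 / 4` of the closed form; the other rates come from the degree sum and the number of vertices. -/
lemma mulSum_corTable (hT : IsHittingTable G T) (q : ℕ) :
    mulSum (edgeCorona q G) (corTable q G T)
      = (q + 1) ^ 3 * ((1 + q / 2) ^ 2 * mulSum G T + q * degSum G ^ 2 / 4
        + q * (1 + q / 2) * (degSum G * (degSum G / 2 * ((3 * degSum G / 2 - 1) / 2)
          - degSum G * (Fintype.card V - 1) / 4))
        + q * (degSum G / 2 * (q * degSum G / 4 - degSum G / 2 * (q / 2 + 1)))) := by
  rw [mulSum, Fintype.sum_sum_type, Fintype.sum_prod_type]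
  simp only [degColSum_corTable_inl, degColSum_corTable_inr, deg_inl, deg_inr, Finset.sum_const,
    Finset.card_univ, Fintype.card_fin, nsmul_eq_mul, mul_assoc, ← Finset.mul_sum,
    mul_left_comm (deg G _), mul_add (deg G _), Finset.sum_add_distrib, Finset.sum_sub_distrib,
    sum_edge_sum_deg_mul_newTarget hT, ← Finset.sum_mul]
  rw [← mulSum, ← degSum, ← two_mul_card_edgeSet G]
  ring

/-- The homogeneous factor `(q + 1) ^ 2 * (1 + q / 2)` gives the growth rate `(q + 2) * (q + 1) ^ 2
/ 2`, which is absent from the multiplicative sum. -/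
lemma addSum_corTable (hT : IsHittingTable G T) (q : ℕ) :
    addSum (edgeCorona q G) (corTable q G T)
      = (q + 1) ^ 2 * ((1 + q / 2) * addSum G T + q * (1 + q / 2) * mulSum G T
        + q * degSum G / 4 * (Fintype.card V + degSum G)
        + q * (Fintype.card V + (1 + q) * degSum G)
          * (degSum G / 2 * ((3 * degSum G / 2 - 1) / 2) - degSum G * (Fintype.card V - 1) / 4)
        - q * degSum G ^ 2 / 2) := by
  rw [addSum, Fintype.sum_sum_type, Fintype.sum_prod_type]
  simp only [colSum_corTable_inl, colSum_corTable_inr, degColSum_corTable_inl,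
    degColSum_corTable_inr, deg_inl, deg_inr, Finset.sum_const,
    Finset.card_univ, Fintype.card_fin, nsmul_eq_mul, mul_assoc, ← Finset.mul_sum,
    mul_left_comm (deg G _), mul_add (deg G _), Finset.sum_add_distrib, Finset.sum_sub_distrib,
    sum_edge_sum_newTarget hT, sum_edge_sum_deg_mul_newTarget hT, ← Finset.sum_mul, addSum]
  rw [← mulSum, ← degSum, ← two_mul_card_edgeSet G]
  ring

end Sums

/-! ### Closed forms on the networks and the passage to hitting times. -/

section Network

open Classical

/-! ### The complete graph -/

lemma nbrSum_top {n : ℕ} (f : Fin n → ℝ) (i : Fin n) :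
    nbrSum (⊤ : SimpleGraph (Fin n)) f i = ∑ k, f k - f i := by
  have : nbrSum (⊤ : SimpleGraph (Fin n)) f i = ∑ k, (f k - if i = k then f k else 0) :=
    Finset.sum_congr rfl fun k _ => by by_cases h : i = k <;> simp [h]
  rw [this, Finset.sum_sub_distrib, Finset.sum_ite_eq, if_pos (Finset.mem_univ i)]

lemma deg_top {n : ℕ} (i : Fin n) : deg (⊤ : SimpleGraph (Fin n)) i = n - 1 := by
  simp [deg, nbrSum_top]

lemma degSum_top (n : ℕ) : degSum (⊤ : SimpleGraph (Fin n)) = n * (n - 1) := by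
  simp only [degSum, deg_top, Finset.sum_const, Finset.card_univ, Fintype.card_fin, nsmul_eq_mul]

/-- The hitting times of the complete graph. -/
def completeTable (n : ℕ) (i j : Fin n) : ℝ := if i = j then 0 else n - 1

lemma colSum_completeTable {n : ℕ} (j : Fin n) :
    colSum (completeTable n) j = (n - 1) ^ 2 := by
  have : ∀ i, completeTable n i j = (n - 1) - if i = j then ((n : ℝ) - 1) else 0 := fun i => by
    rw [completeTable]; split_ifs <;> ring
  simp only [colSum, this, Finset.sum_sub_distrib, Finset.sum_ite_eq', Finset.mem_univ, if_true,
    Finset.sum_const, Finset.card_univ, Fintype.card_fin, nsmul_eq_mul]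
  ring

lemma degColSum_completeTable {n : ℕ} (j : Fin n) :
    degColSum ⊤ (completeTable n) j = (n - 1) ^ 3 := by
  have := colSum_completeTable j
  rw [colSum] at this
  simp only [degColSum, deg_top, ← Finset.mul_sum, this]
  ring

lemma isHittingTable_completeTable {n : ℕ} (hn : 2 ≤ n) :
    IsHittingTable (⊤ : SimpleGraph (Fin n)) (completeTable n) where
  self j := by simp [completeTable]
  nonneg i j := by
    have : (2 : ℝ) ≤ n := by exact_mod_cast hn
    rw [completeTable]
    split_ifs <;> linarith
  lap_eq i j := by
    have := colSum_completeTable j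
    rw [colSum] at this
    rw [lap, nbrSum_top, this, deg_top, degSum_top, completeTable]
    split_ifs <;> ring
  commute_le i j h := by
    have : (2 : ℝ) ≤ n := by exact_mod_cast hn
    have hij : i ≠ j := h
    rw [degSum_top, completeTable, completeTable, if_neg hij, if_neg hij.symm]
    nlinarith

/-! ### The networks -/

/-- The additive-degree sum of hitting times after `g` iterations. -/
def addSumFormula (q g : ℕ) : ℝ :=
  2 * ((q : ℝ) + 2) ^ 2 * ((q : ℝ) + 1) ^ 3 / ((q : ℝ) + 3) ^ 2
      * ((((q : ℝ) + 1) * ((q : ℝ) + 2)) / 2) ^ (2 * g)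
    + ((q : ℝ) + 2) * (3 * (q : ℝ) + 7) * ((q : ℝ) + 1) ^ 3
        * ((q : ℝ) ^ 3 + 8 * (q : ℝ) ^ 2 + 22 * (q : ℝ) + 20)
        / (((q : ℝ) + 3) ^ 2 * ((q : ℝ) ^ 2 + 5 * (q : ℝ) + 8))
      * ((((q : ℝ) + 1) * ((q : ℝ) + 2)) / 2) ^ (3 * g)
    - ((q : ℝ) + 2) * ((q : ℝ) + 4) * ((q : ℝ) + 1) ^ 3 / ((q : ℝ) + 3)
      * ((((q : ℝ) + 2) ^ 2 * ((q : ℝ) + 1) ^ 3) / 4) ^ g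
    + ((q : ℝ) + 2) * ((q : ℝ) ^ 2 + 9 * (q : ℝ) + 20) * ((q : ℝ) + 1) ^ 3
        / (((q : ℝ) + 3) * ((q : ℝ) ^ 2 + 5 * (q : ℝ) + 8))
      * ((((q : ℝ) + 2) * ((q : ℝ) + 1) ^ 2) / 2) ^ g
    + ((q : ℝ) + 2) * ((q : ℝ) + 1) ^ 3 / ((q : ℝ) + 3) ^ 2
      * ((((q : ℝ) + 1) * ((q : ℝ) + 2)) / 2) ^ g

/-- The multiplicative-degree sum of hitting times after `g` iterations. -/
def mulSumFormula (q g : ℕ) : ℝ :=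
  ((q : ℝ) + 2) * (q + 1) ^ 3 / (q + 3)
    * (-((q + 3) * (q + 4) / 2) * (((q + 2) ^ 2 * (q + 1) ^ 3) / 4) ^ g
      + (3 * q + 7) * (q + 2) / 2 * ((q + 1) * (q + 2) / 2) ^ (3 * g)
      + (q + 2) * ((q + 1) * (q + 2) / 2) ^ (2 * g))

/-- `G` has a table of hitting times, and the sums that enter the recursion have the values
they take on the `g`-th network. -/
def HasNetworkTable (q g : ℕ) {V : Type} [Fintype V] (G : SimpleGraph V) : Prop :=
  ∃ T : V → V → ℝ, IsHittingTable G T ∧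
    degSum G = 2 * (((q : ℝ) + 1) * (q + 2) / 2) ^ (g + 1) ∧
    (Fintype.card V : ℝ)
      = q + 2 + (q + 1) * (q + 2) / (q + 3) * ((((q : ℝ) + 1) * (q + 2) / 2) ^ g - 1) ∧
    mulSum G T = mulSumFormula q g ∧ addSum G T = addSumFormula q g

lemma hasNetworkTable_zero (q : ℕ) : HasNetworkTable q 0 (⊤ : SimpleGraph (Fin (q + 2))) := by
  refine ⟨completeTable (q + 2), isHittingTable_completeTable (by omega), ?_, ?_, ?_, ?_⟩
  · rw [degSum_top]; push_cast; ring
  · simp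
  · simp only [mulSum, deg_top, degColSum_completeTable, Finset.sum_const, Finset.card_univ,
      Fintype.card_fin, nsmul_eq_mul, mulSumFormula]
    push_cast
    field_simp
    ring
  · simp only [addSum, deg_top, degColSum_completeTable, colSum_completeTable, Finset.sum_const,
      Finset.card_univ, Fintype.card_fin, nsmul_eq_mul, addSumFormula]
    push_cast
    field_simp
    ring

lemma HasNetworkTable.edgeCorona {q g : ℕ} {V : Type} [Fintype V] {G : SimpleGraph V}
    (h : HasNetworkTable q g G) : HasNetworkTable q (g + 1) (EdgeCorona.edgeCorona q G) := by
  obtain ⟨T, hT, hD, hN, hM, hA⟩ := h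
  refine ⟨corTable q G T, hT.corTable, ?_, ?_, ?_, ?_⟩
  · rw [degSum_edgeCorona, hD]; ring
  · rw [card_edgeCorona, hN, hD, pow_succ]
    generalize (((q : ℝ) + 1) * (q + 2) / 2) ^ g = R
    field_simp
    ring
  · rw [mulSum_corTable hT, hM, hD, hN]
    simp only [mulSumFormula, mul_comm 2 (g + 1), mul_comm 3 (g + 1), mul_comm 2 g, mul_comm 3 g,
      pow_mul, pow_succ _ g]
    -- All powers are now polynomial in the `g`-th powers of the growth rates; with these as
    -- indeterminates the claim is an identity of rational functions.
    generalize (((q : ℝ) + 1) * (q + 2) / 2) ^ g = R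
    generalize (((q : ℝ) + 2) ^ 2 * (q + 1) ^ 3 / 4) ^ g = L
    field_simp
    ring
  · rw [addSum_corTable hT, hM, hA, hD, hN]
    simp only [mulSumFormula, addSumFormula, mul_comm 2 (g + 1), mul_comm 3 (g + 1), mul_comm 2 g,
      mul_comm 3 g, pow_mul, pow_succ _ g]
    generalize (((q : ℝ) + 1) * (q + 2) / 2) ^ g = R
    generalize (((q : ℝ) + 2) ^ 2 * (q + 1) ^ 3 / 4) ^ g = L
    generalize (((q : ℝ) + 2) * (q + 1) ^ 2 / 2) ^ g = K
    -- This denominator comes from the gap between two growth rates: `((q + 1) (q + 2) / 2)³ - (q +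
    -- 2) (q + 1)² / 2 = q (q + 1)² (q + 2) (q² + 5 q + 8) / 8`.
    have h8 : (q : ℝ) ^ 2 + 5 * q + 8 ≠ 0 := by positivity
    field_simp
    ring

lemma hasNetworkTable_graph (q g : ℕ) : HasNetworkTable q g (graph q g) := by
  induction g with
  | zero =>
    -- `fintypeVert` is obtained from finiteness alone; it is exchanged for the structural instance
    -- used in the lemmas on complete graphs and coronas.
    rw [Subsingleton.elim (fintypeVert q 0) (inferInstanceAs (Fintype (Fin (q + 2))))]
    exact hasNetworkTable_zero q
  | succ g ih =>
    let : Fintype (network q g).1 := fintypeVert q g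
    rw [Subsingleton.elim (fintypeVert q (g + 1)) (inferInstanceAs
      (Fintype ((network q g).1 ⊕ ((network q g).2.edgeSet × Fin q))))]
    exact HasNetworkTable.edgeCorona (G := (network q g).2) ih

/-! ### From tables to hitting times -/

variable {V : Type} [Fintype V] {G : SimpleGraph V} {T : V → V → ℝ}

lemma nbrSum_eq_sum_neighborFinset (G : SimpleGraph V) (f : V → ℝ) (i : V) :
    nbrSum G f i = ∑ k ∈ G.neighborFinset i, f k := by
  rw [nbrSum, ← Finset.sum_filter]
  refine Finset.sum_congr ?_ fun _ _ => rfl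
  ext k; simp

lemma deg_eq_degree (G : SimpleGraph V) (i : V) : deg G i = G.degree i := by
  rw [deg, nbrSum_eq_sum_neighborFinset]; simp

theorem IsHittingTable.hittingTime_eq (hT : IsHittingTable G T) (hD : degSum G ≠ 0) (i j : V) :
    hittingTime G i j = ENNReal.ofReal (T i j) := by
  refine hittingTime_eq_ofReal G (fun k => ?_) j (fun k => T k j) (fun k => hT.nonneg k j)
    (hT.self j) (fun k hk => ?_) i
  -- At an isolated vertex the equation at the target would read `0 = 0 - degSum G`.
  · by_contra hne
    have h1 := hT.lap_eq k k
    rw [lap, deg, nbrSum_eq_sum_neighborFinset, nbrSum_eq_sum_neighborFinset,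
      Finset.not_nonempty_iff_eq_empty.1 hne] at h1
    simp only [Finset.sum_empty, if_true] at h1
    exact hD (by linarith)
  · have h1 := hT.lap_eq k j
    rw [lap, deg_eq_degree, nbrSum_eq_sum_neighborFinset, if_neg hk] at h1
    linarith

theorem IsHittingTable.additiveDegreeSum_eq (hT : IsHittingTable G T) (hD : degSum G ≠ 0) :
    additiveDegreeSum G = addSum G T := by
  simp only [additiveDegreeSum, hT.hittingTime_eq hD, ENNReal.toReal_ofReal (hT.nonneg _ _),
    addSum, degColSum, colSum, Finset.mul_sum, ← Finset.sum_add_distrib]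
  rw [Finset.sum_comm]
  simp only [deg_eq_degree, add_mul]

end Network

end EdgeCorona

end

theorem mainTheorem5 (q : ℕ) (hq : 1 ≤ q) (g : ℕ) :
    (∀ i j : EdgeCorona.Vert q g, EdgeCorona.hittingTime (EdgeCorona.graph q g) i j ≠ ⊤) ∧
    EdgeCorona.additiveDegreeSum (EdgeCorona.graph q g) =
      2 * ((q : ℝ) + 2) ^ 2 * ((q : ℝ) + 1) ^ 3 / ((q : ℝ) + 3) ^ 2
          * ((((q : ℝ) + 1) * ((q : ℝ) + 2)) / 2) ^ (2 * g)
        + ((q : ℝ) + 2) * (3 * (q : ℝ) + 7) * ((q : ℝ) + 1) ^ 3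
            * ((q : ℝ) ^ 3 + 8 * (q : ℝ) ^ 2 + 22 * (q : ℝ) + 20)
            / (((q : ℝ) + 3) ^ 2 * ((q : ℝ) ^ 2 + 5 * (q : ℝ) + 8))
          * ((((q : ℝ) + 1) * ((q : ℝ) + 2)) / 2) ^ (3 * g)
        - ((q : ℝ) + 2) * ((q : ℝ) + 4) * ((q : ℝ) + 1) ^ 3 / ((q : ℝ) + 3)
          * ((((q : ℝ) + 2) ^ 2 * ((q : ℝ) + 1) ^ 3) / 4) ^ g
        + ((q : ℝ) + 2) * ((q : ℝ) ^ 2 + 9 * (q : ℝ) + 20) * ((q : ℝ) + 1) ^ 3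
            / (((q : ℝ) + 3) * ((q : ℝ) ^ 2 + 5 * (q : ℝ) + 8))
          * ((((q : ℝ) + 2) * ((q : ℝ) + 1) ^ 2) / 2) ^ g
        + ((q : ℝ) + 2) * ((q : ℝ) + 1) ^ 3 / ((q : ℝ) + 3) ^ 2
          * ((((q : ℝ) + 1) * ((q : ℝ) + 2)) / 2) ^ g := by
  obtain ⟨T, hT, hD, -, -, hA⟩ := EdgeCorona.hasNetworkTable_graph q g
  have hne : EdgeCorona.degSum (EdgeCorona.graph q g) ≠ 0 := by
    rw [hD]; positivity
  refine ⟨fun i j => ?_, ?_⟩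
  · rw [hT.hittingTime_eq hne]
    exact ENNReal.ofReal_ne_top
  · rw [hT.additiveDegreeSum_eq hne, hA, EdgeCorona.addSumFormula]
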